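/- Let $K$ be a field, let $r\ge 0$ and $n\ge 1$ be integers with $n\ge r$. Let $\widehat\Sigma_r=\Sigma_r\ltimes\mathbb Z^r$ be the extended affine Weyl group of type $A_{r-1}$, acting on the right on $I(\mathbb Z,r)=\mathbb Z^r$, where $\Sigma_r$ acts by place permutation and $\varepsilon\in\mathbb Z^r$ acts by $\underline i\mapsto\underline i+n\varepsilon$, and acting diagonally on $I(\mathbb Z,r)\times I(\mathbb Z,r)$. Write $\sim$ for lying in the same $\widehat\Sigma_r$-orbit. The affine Schur algebra $\widetilde S(n,r)$ is the unital $K$-algebra with one basis element $\xi_{\underline i,\underline j}$ for each orbit of pairs $(\underline i,\underline j)$ and with the multiplication $$\xi_{\underline i,\underline j}\,\xi_{\underline k,\underline l}=\sum_{(\underline p,\underline q)}\#\{\underline s\in I(\mathbb Z,r) : (\underline p,\underline s)\sim(\underline i,\underline j),\ (\underline s,\underline q)\sim(\underline k,\underline l)\}\;\xi_{\underline p,\underline q},$$ where $(\underline p,\underline q)$ runs over representatives of the orbits of pairs. Let $\underline u=(1,\dots,r)$; then $\xi_{\underline u,\underline u}$ is an idempotent. (1) The map $w\mapsto\xi_{\underline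 u,\underline u w^{-1}}$ extends linearly to an isomorphism of $K$-algebras from the group algebra $K\widehat\Sigma_r$ onto $\xi_{\underline u,\underline u}\widetilde S(n,r)\xi_{\underline u,\underline u}$. (2) Assume that $\operatorname{char}K=0$ or $\operatorname{char}K>r$. Then the Schur functor $W\mapsto\xi_{\underline u,\underline u}W$, from left $\widetilde S(n,r)$-modules to left $K\widehat\Sigma_r$-modules, where $K\widehat\Sigma_r$ acts on $\xi_{\underline u,\underline u}W$ through the isomorphism in (1), is an equivalence of categories. -/

import Mathlib

universe u v

noncomputable section

/-- The extended affine Weyl group `Σ_r ⋉ ℤ^r` of type `A_{r-1}`, where a permutation `σ` acts on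
`ℤ^r` (written multiplicatively) by `ε ↦ ε ∘ σ⁻¹`. -/
abbrev ExtAffineWeyl (r : ℕ) : Type :=
  (Fin r → Multiplicative ℤ) ⋊[mulAutArrow] (Equiv.Perm (Fin r))

namespace AffineSchur

/-- The right action of `Σ_r ⋉ ℤ^r` on `I(ℤ, r)`: the element `ε σ` sends `i` to
`(i + n ε) ∘ σ`. So `σ` acts by place permutation and `ε` acts by `i ↦ i + n ε`. -/
def act {r : ℕ} (n : ℕ) (i : Fin r → ℤ) (w : ExtAffineWeyl r) : Fin r → ℤ :=
  fun t => i (w.right t) + (n : ℤ) * (w.left (w.right t)).toAdd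

section action
variable {n r : ℕ}

lemma act_inr (i : Fin r → ℤ) (σ : Equiv.Perm (Fin r)) :
    act n i (SemidirectProduct.inr σ) = i ∘ σ := by
  funext t; simp [act]

lemma act_inl (i : Fin r → ℤ) (ε : Fin r → Multiplicative ℤ) :
    act n i (SemidirectProduct.inl ε) = fun t => i t + n * (ε t).toAdd := by
  funext t; simp [act]

lemma act_one (i : Fin r → ℤ) : act n i 1 = i := by
  funext t; simp [act]

lemma act_mul (i : Fin r → ℤ) (w w' : ExtAffineWeyl r) :
    act n i (w * w') = act n (act n i w) w' := by
  funext t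
  have h : (mulAutArrow w.right w'.left) (w.right (w'.right t)) = w'.left (w'.right t) :=
    congrArg w'.left (w.right.symm_apply_apply (w'.right t))
  simp only [act, SemidirectProduct.mul_left, SemidirectProduct.mul_right, Equiv.Perm.mul_apply,
    Pi.mul_apply, toAdd_mul, h]
  ring

end action

/-- `(i, j) ∼ (k, l)` when some `w` in the extended affine Weyl group satisfies
`k = i w` and `l = j w`. -/
def pairSetoid (n r : ℕ) : Setoid ((Fin r → ℤ) × (Fin r → ℤ)) where
  r x y := ∃ w : ExtAffineWeyl r, act n x.1 w = y.1 ∧ act n x.2 w = y.2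
  iseqv :=
    { refl := fun x => ⟨1, act_one _, act_one _⟩
      symm := by
        rintro x y ⟨w, h1, h2⟩
        refine ⟨w⁻¹, ?_, ?_⟩
        · rw [← h1, ← act_mul, mul_inv_cancel, act_one]
        · rw [← h2, ← act_mul, mul_inv_cancel, act_one]
      trans := by
        rintro x y z ⟨w, h1, h2⟩ ⟨w', h3, h4⟩
        exact ⟨w * w', by rw [act_mul, h1, h3], by rw [act_mul, h2, h4]⟩ }

/-- The orbits of the extended affine Weyl group on `I(ℤ, r) × I(ℤ, r)`. -/
def Orbit (n r : ℕ) : Type := Quotient (pairSetoid n r)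

/-- The orbit of `(i, j)`. -/
def orb (n : ℕ) {r : ℕ} (i j : Fin r → ℤ) : Orbit n r := Quotient.mk (pairSetoid n r) (i, j)

section orbits
variable {n r : ℕ}

lemma orb_eq_iff {i j k l : Fin r → ℤ} :
    orb n i j = orb n k l ↔ ∃ w : ExtAffineWeyl r, act n i w = k ∧ act n j w = l :=
  Quotient.eq (r := pairSetoid n r)

lemma orb_act (i j : Fin r → ℤ) (w : ExtAffineWeyl r) :
    orb n (act n i w) (act n j w) = orb n i j :=
  (orb_eq_iff.2 ⟨w, rfl, rfl⟩).symm

lemma exists_orb (a : Orbit n r) : ∃ i j, a = orb n i j := by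
  induction a using Quotient.inductionOn with
  | h x => exact ⟨x.1, x.2, rfl⟩

lemma act_bijective (w : ExtAffineWeyl r) : Function.Bijective fun i => act n i w :=
  Function.bijective_iff_has_inverse.2 ⟨fun i => act n i w⁻¹,
    fun i => by simp [← act_mul, act_one], fun i => by simp [← act_mul, act_one]⟩

/-- In a fixed row, an orbit has finitely many entries. -/
lemma finite_row (a : Orbit n r) (p : Fin r → ℤ) : {s | orb n p s = a}.Finite := by
  obtain ⟨i, j, rfl⟩ := exists_orb a
  refine (Set.finite_range fun σ : Equiv.Perm (Fin r) =>
    fun t => j (σ t) + (p t - i (σ t))).subset ?_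
  intro s hs
  obtain ⟨w, h1, h2⟩ := orb_eq_iff.1 (Eq.symm hs)
  refine ⟨w.right, ?_⟩
  funext t
  rw [← h1, ← h2]
  simp [act]

end orbits

/-- For orbits `a`, `b` and the orbit `c` of `(p, q)`, the structure constant
`#{s ∈ I(ℤ, r) | (p, s) ∈ a, (s, q) ∈ b}`. -/
def structConst {n r : ℕ} (a b c : Orbit n r) : ℕ :=
  Quotient.liftOn c (fun x => {s : Fin r → ℤ | orb n x.1 s = a ∧ orb n s x.2 = b}.ncard) (by
    rintro ⟨p, q⟩ ⟨p', q'⟩ ⟨w, h1, h2⟩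
    dsimp only at h1 h2 ⊢
    subst h1 h2
    refine Set.ncard_congr (fun s _ => act n s w) ?_ ?_ ?_
    · rintro s ⟨h, h'⟩
      exact ⟨by rw [orb_act, h], by rw [orb_act, h']⟩
    · intro s s' _ _ h
      exact (act_bijective w).1 h
    · rintro s ⟨h, h'⟩
      obtain ⟨s, rfl⟩ := (act_bijective (n := n) w).2 s
      exact ⟨s, ⟨by rw [← h, orb_act], by rw [← h', orb_act]⟩, rfl⟩)

section consts
variable {n r : ℕ}

lemma structConst_orb (a b : Orbit n r) (p q : Fin r → ℤ) :
    structConst a b (orb n p q) = {s : Fin r → ℤ | orb n p s = a ∧ orb n s q = b}.ncard := rfl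

lemma finite_structConst (a b : Orbit n r) : {c | structConst a b c ≠ 0}.Finite := by
  obtain ⟨i, j, rfl⟩ := exists_orb a
  refine (((finite_row (orb n i j) i).biUnion fun s _ => finite_row b s).image
    fun q => orb n i q).subset ?_
  intro c hc
  obtain ⟨p, q, rfl⟩ := exists_orb c
  obtain ⟨s, h1, h2⟩ := Set.nonempty_of_ncard_ne_zero hc
  obtain ⟨w, rfl, rfl⟩ := orb_eq_iff.1 h1
  refine ⟨act n q w, Set.mem_biUnion (x := act n s w) rfl ?_, orb_act _ _ _⟩
  show orb n _ _ = b
  rw [orb_act, h2]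

end consts

end AffineSchur

open AffineSchur in
/-- The affine Schur algebra `S̃(n, r)` over `K`: the `K`-vector space with basis the orbits of the
extended affine Weyl group on `I(ℤ, r) × I(ℤ, r)`. -/
def AffineSchurAlgebra (K : Type u) [Field K] (n r : ℕ) : Type u := Orbit n r →₀ K

namespace AffineSchur

variable {K : Type u} [Field K] {n r : ℕ}

instance : AddCommGroup (AffineSchurAlgebra K n r) :=
  inferInstanceAs (AddCommGroup (Orbit n r →₀ K))

instance : Module K (AffineSchurAlgebra K n r) :=
  inferInstanceAs (Module K (Orbit n r →₀ K))

/-- The basis vector of an orbit. -/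
def basisVec (K : Type u) [Field K] (a : Orbit n r) : AffineSchurAlgebra K n r :=
  Finsupp.single a (1 : K)

/-- The basis element `ξ_{i,j}`. -/
def xi (K : Type u) [Field K] (n : ℕ) {r : ℕ} (i j : Fin r → ℤ) : AffineSchurAlgebra K n r :=
  basisVec K (orb n i j)

/-- The product of the basis vectors of `a` and `b`, that is, the finite sum
`∑_c structConst a b c • basisVec c`. -/
def mulBasis (K : Type u) [Field K] (a b : Orbit n r) : AffineSchurAlgebra K n r :=
  Finsupp.ofSupportFinite (fun c => (structConst a b c : K))
    ((finite_structConst a b).subset fun c hc h => hc (by simp [h]))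

/-- The multiplication of the affine Schur algebra: the bilinear extension of `mulBasis`. -/
instance : Mul (AffineSchurAlgebra K n r) where
  mul f g := Finsupp.sum f fun a x => Finsupp.sum g fun b y => (x * y) • mulBasis K a b

/-- The identity: the sum of the `ξ_{i,i}` over `i ∈ I(n, r)` modulo place permutation. -/
instance : One (AffineSchurAlgebra K n r) where
  one := by
    classical
    exact ∑ a ∈ Finset.univ.image fun i : Fin r → Fin n =>
      orb n (fun t => (i t : ℤ) + 1) (fun t => (i t : ℤ) + 1), basisVec K a

/-- The coefficient at the orbit of `(p, q)`. -/
def ent (p q : Fin r → ℤ) : AffineSchurAlgebra K n r →ₗ[K] K := Finsupp.lapply (orb n p q)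

lemma ent_ext {f g : AffineSchurAlgebra K n r} (h : ∀ p q, ent p q f = ent p q g) : f = g := by
  refine Finsupp.ext fun c => ?_
  obtain ⟨p, q, rfl⟩ := exists_orb c
  exact h p q

lemma ent_basisVec (p q : Fin r → ℤ) (a : Orbit n r) [Decidable (orb n p q = a)] :
    ent p q (basisVec K a) = if orb n p q = a then 1 else 0 := by
  classical
  show (Finsupp.single a (1 : K)) (orb n p q) = _
  rw [Finsupp.single_apply]
  by_cases h : orb n p q = a
  · simp [h]
  · simp [h, Ne.symm h]

lemma ent_mulBasis (p q : Fin r → ℤ) (a b : Orbit n r) :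
    ent p q (mulBasis K a b) = (structConst a b (orb n p q) : K) := rfl

lemma finite_ent_row (f : AffineSchurAlgebra K n r) (p : Fin r → ℤ) :
    {s | ent p s f ≠ 0}.Finite := by
  refine ((Finset.finite_toSet (Finsupp.support (M := K) f)).biUnion fun a _ => finite_row a p).subset ?_
  intro s hs
  exact Set.mem_biUnion (x := orb n p s) (Finsupp.mem_support_iff.2 hs) rfl

lemma mul_def' (f g : AffineSchurAlgebra K n r) :
    f * g = ∑ a ∈ Finsupp.support (M := K) f, ∑ b ∈ Finsupp.support (M := K) g,
      (Finsupp.toFun f a * Finsupp.toFun g b) • mulBasis K a b := rfl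

/-- Entries of a product are given by matrix multiplication. -/
lemma ent_mul (f g : AffineSchurAlgebra K n r) (p q : Fin r → ℤ) (T : Finset (Fin r → ℤ))
    (hT : ∀ s, ent p s f ≠ 0 → s ∈ T) :
    ent p q (f * g) = ∑ s ∈ T, ent p s f * ent s q g := by
  classical
  have key : ∀ a ∈ Finsupp.support (M := K) f, ∀ b,
      (structConst a b (orb n p q) : K) =
        ∑ s ∈ T ∪ (finite_row a p).toFinset, (if orb n p s = a then (1 : K) else 0) *
          (if orb n s q = b then 1 else 0) := by
    intro a _ b
    rw [structConst_orb]
    simp only [← ite_and, mul_ite, mul_one, mul_zero]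
    have : {s : Fin r → ℤ | orb n p s = a ∧ orb n s q = b} =
        ((T ∪ (finite_row a p).toFinset).filter fun s => orb n p s = a ∧ orb n s q = b) := by
      ext s
      simp +contextual
    rw [this, Set.ncard_coe_finset, Finset.card_filter]
    push_cast
    refine Finset.sum_congr rfl fun s _ => ?_
    by_cases h1 : orb n p s = a <;> by_cases h2 : orb n s q = b <;> simp [h1, h2]
  set U : Finset (Fin r → ℤ) :=
    T ∪ (Finsupp.support (M := K) f).biUnion fun a => (finite_row a p).toFinset with hU
  have key' : ∀ a ∈ Finsupp.support (M := K) f, ∀ b,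
      (structConst a b (orb n p q) : K) =
        ∑ s ∈ U, (if orb n p s = a then (1 : K) else 0) *
          (if orb n s q = b then 1 else 0) := by
    intro a ha b
    rw [key a ha b]
    refine Finset.sum_subset ?_ ?_
    · refine Finset.union_subset_union le_rfl ?_
      exact Finset.subset_biUnion_of_mem (fun a => (finite_row a p).toFinset) ha
    · intro s _ hs
      have : ¬ orb n p s = a := fun h => hs (Finset.mem_union_right _ (by simpa using h))
      simp [this]
  have hf : ∀ s, ent p s f =
      ∑ a ∈ Finsupp.support (M := K) f, (if orb n p s = a then Finsupp.toFun f a else 0) := by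
    intro s
    rw [Finset.sum_ite_eq]
    split_ifs with h
    · rfl
    · exact Finsupp.notMem_support_iff.1 h
  have hg : ∀ s, ent s q g =
      ∑ b ∈ Finsupp.support (M := K) g, (if orb n s q = b then Finsupp.toFun g b else 0) := by
    intro s
    rw [Finset.sum_ite_eq]
    split_ifs with h
    · rfl
    · exact Finsupp.notMem_support_iff.1 h
  have hTU : ∑ s ∈ T, ent p s f * ent s q g = ∑ s ∈ U, ent p s f * ent s q g := by
    refine Finset.sum_subset Finset.subset_union_left fun s _ hs => ?_
    have : ent p s f = 0 := by
      by_contra h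
      exact hs (hT s h)
    rw [this, zero_mul]
  have hR : ∑ s ∈ U, ent p s f * ent s q g =
      ∑ a ∈ Finsupp.support (M := K) f, ∑ b ∈ Finsupp.support (M := K) g, ∑ s ∈ U,
        (if orb n p s = a then Finsupp.toFun f a else 0) *
          (if orb n s q = b then Finsupp.toFun g b else 0) := by
    simp_rw [hf, hg, Finset.sum_mul_sum]
    rw [Finset.sum_comm]
    refine Finset.sum_congr rfl fun a _ => ?_
    rw [Finset.sum_comm]
  rw [hTU, hR, mul_def', map_sum]
  refine Finset.sum_congr rfl fun a ha => ?_
  rw [map_sum]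
  refine Finset.sum_congr rfl fun b _ => ?_
  rw [map_smul, ent_mulBasis, key' a ha b, smul_eq_mul, Finset.mul_sum]
  refine Finset.sum_congr rfl fun s _ => ?_
  by_cases h1 : orb n p s = a <;> by_cases h2 : orb n s q = b <;> simp [h1, h2]

lemma basisVec_mul_basisVec (a b : Orbit n r) :
    basisVec K a * basisVec K b = mulBasis K a b := by
  show Finsupp.sum (Finsupp.single a (1 : K)) (fun a x =>
    Finsupp.sum (Finsupp.single b (1 : K)) fun b y => (x * y) • mulBasis K a b) = _
  rw [Finsupp.sum_single_index, Finsupp.sum_single_index] <;> simp [Finsupp.sum]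

/-- Every `i` is equivalent to an element of `I(n, r)`. -/
lemma exists_fin [NeZero n] (p : Fin r → ℤ) : ∃ (i : Fin r → Fin n) (w : ExtAffineWeyl r),
    act n (fun t => (i t : ℤ) + 1) w = p := by
  have hn : (0 : ℤ) < n := by exact_mod_cast Nat.pos_of_ne_zero (NeZero.ne n)
  refine ⟨fun t => ⟨((p t - 1) % n).toNat, ?_⟩,
    SemidirectProduct.inl fun t => Multiplicative.ofAdd ((p t - 1) / n), ?_⟩
  · have h1 := Int.emod_lt_of_pos (p t - 1) hn
    have h2 := Int.emod_nonneg (p t - 1) hn.ne'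
    omega
  · rw [act_inl]
    funext t
    have h2 := Int.emod_nonneg (p t - 1) hn.ne'
    have h3 := Int.emod_add_mul_ediv (p t - 1) n
    simp only [toAdd_ofAdd, Int.toNat_of_nonneg h2]
    linarith

lemma ent_one [NeZero n] [DecidableEq (Fin r → ℤ)] (p q : Fin r → ℤ) :
    ent p q (1 : AffineSchurAlgebra K n r) = if p = q then 1 else 0 := by
  classical
  show ent p q (∑ a ∈ Finset.univ.image fun i : Fin r → Fin n =>
      orb n (fun t => (i t : ℤ) + 1) (fun t => (i t : ℤ) + 1), basisVec K a) = _
  rw [map_sum]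
  simp_rw [ent_basisVec]
  rw [Finset.sum_ite_eq]
  refine if_congr ?_ rfl rfl
  rw [Finset.mem_image]
  constructor
  · rintro ⟨i, -, h⟩
    obtain ⟨w, h1, h2⟩ := orb_eq_iff.1 h
    rw [← h1, ← h2]
  · rintro rfl
    obtain ⟨i, w, h⟩ := exists_fin (n := n) p
    exact ⟨i, Finset.mem_univ _, orb_eq_iff.2 ⟨w, h, h⟩⟩

lemma as_mul_assoc (f g h : AffineSchurAlgebra K n r) : f * g * h = f * (g * h) := by
  classical
  refine ent_ext fun p q => ?_
  set T := (finite_ent_row f p).toFinset with hT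
  set U := T.biUnion fun t => (finite_ent_row g t).toFinset with hU
  have mT : ∀ s, ent p s f ≠ 0 → s ∈ T := fun s hs => by simpa [hT] using hs
  have mU : ∀ t ∈ T, ∀ s, ent t s g ≠ 0 → s ∈ U := fun t ht s hs =>
    Finset.mem_biUnion.2 ⟨t, ht, by simpa using hs⟩
  rw [ent_mul (f * g) h p q U, ent_mul f (g * h) p q T mT]
  · rw [Finset.sum_congr rfl fun s _ => by rw [ent_mul f g p s T mT, Finset.sum_mul],
      Finset.sum_comm]
    refine Finset.sum_congr rfl fun t ht => ?_
    rw [ent_mul g h t q U (mU t ht), Finset.mul_sum]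
    exact Finset.sum_congr rfl fun s _ => mul_assoc _ _ _
  · intro s hs
    rw [ent_mul f g p s T mT] at hs
    obtain ⟨t, ht, hts⟩ := Finset.exists_ne_zero_of_sum_ne_zero hs
    exact mU t ht s (right_ne_zero_of_mul hts)

lemma ent_mul_self (f g : AffineSchurAlgebra K n r) (p q : Fin r → ℤ) :
    ent p q (f * g) = ∑ s ∈ (finite_ent_row f p).toFinset, ent p s f * ent s q g :=
  ent_mul f g p q _ fun s hs => by simpa using hs

/-- The affine Schur algebra is a ring. -/
instance [NeZero n] : Ring (AffineSchurAlgebra K n r) where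
  __ := (inferInstance : AddCommGroup (AffineSchurAlgebra K n r))
  mul_assoc := as_mul_assoc
  zero_mul g := rfl
  mul_zero f := ent_ext fun p q => by simp [ent_mul_self]
  one_mul f := ent_ext fun p q => by
    classical
    rw [ent_mul 1 f p q {p}] <;> simp +contextual [ent_one, eq_comm]
  mul_one f := ent_ext fun p q => by
    classical
    rw [ent_mul_self]
    simp only [ent_one, mul_ite, mul_one, mul_zero, Finset.sum_ite_eq']
    split_ifs with h
    · rfl
    · by_contra h'
      exact h (by simpa using Ne.symm h')
  left_distrib f g h := ent_ext fun p q => by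
    simp only [ent_mul_self, map_add, mul_add, Finset.sum_add_distrib]
  right_distrib f g h := ent_ext fun p q => by
    classical
    have hf : ∀ s, ent p s f ≠ 0 →
        s ∈ (finite_ent_row f p).toFinset ∪ (finite_ent_row g p).toFinset := fun s hs =>
      Finset.mem_union_left _ (by simpa using hs)
    have hg : ∀ s, ent p s g ≠ 0 →
        s ∈ (finite_ent_row f p).toFinset ∪ (finite_ent_row g p).toFinset := fun s hs =>
      Finset.mem_union_right _ (by simpa using hs)
    rw [map_add, ent_mul f h p q _ hf, ent_mul g h p q _ hg, ent_mul (f + g) h p q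
      ((finite_ent_row f p).toFinset ∪ (finite_ent_row g p).toFinset)]
    · simp only [map_add, add_mul, Finset.sum_add_distrib]
    · intro s hs
      by_contra hn
      refine hs ?_
      rw [map_add, not_not.1 (fun h => hn (hf s h)), not_not.1 (fun h => hn (hg s h)), add_zero]

/-- The affine Schur algebra is a `K`-algebra. -/
instance [NeZero n] : Algebra K (AffineSchurAlgebra K n r) :=
  Algebra.ofModule
    (fun c f g => ent_ext fun p q => by
      rw [map_smul, ent_mul f g p q (finite_ent_row f p).toFinset (by simp),
        ent_mul (c • f) g p q (finite_ent_row f p).toFinset]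
      · simp only [map_smul, smul_eq_mul, Finset.mul_sum, mul_assoc]
      · intro s hs
        rw [map_smul, smul_eq_mul] at hs
        simpa using right_ne_zero_of_mul hs)
    (fun c f g => ent_ext fun p q => by
      simp only [ent_mul_self, map_smul, smul_eq_mul, Finset.mul_sum, mul_left_comm])

/-- The tuple `u = (1, …, r)`. -/
def uTuple (r : ℕ) : Fin r → ℤ := fun t => (t : ℤ) + 1

/-- For `r ≤ n` the entries of `u` are distinct modulo `n`, so its stabilizer is trivial. -/
lemma act_uTuple_injective (h : r ≤ n) :
    Function.Injective fun w : ExtAffineWeyl r => act n (uTuple r) w := by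
  intro w w' hw
  have key : ∀ t, w.right t = w'.right t ∧
      w.left (w.right t) = w'.left (w'.right t) := by
    intro t
    have ht := congrFun hw t
    simp only [act, uTuple] at ht
    have hn : (0 : ℤ) < n := by have := t.pos; omega
    have e1 : ((w.right t : ℕ) : ℤ) = ((w'.right t : ℕ) : ℤ) := by
      have := congrArg (· % (n : ℤ)) (show ((w.right t : ℕ) : ℤ) +
        n * (w.left (w.right t)).toAdd = ((w'.right t : ℕ) : ℤ) +
        n * (w'.left (w'.right t)).toAdd by linarith)
      simp only [Int.add_mul_emod_self_left] at this
      rwa [Int.emod_eq_of_lt (by omega) (by have := (w.right t).2; omega),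
        Int.emod_eq_of_lt (by omega) (by have := (w'.right t).2; omega)] at this
    refine ⟨Fin.ext (by exact_mod_cast e1), ?_⟩
    rw [e1] at ht
    have h2 : (n : ℤ) * (w.left (w.right t)).toAdd = n * (w'.left (w'.right t)).toAdd := by
      linarith
    exact Multiplicative.toAdd.injective (mul_left_cancel₀ hn.ne' h2)
  have hr : w.right = w'.right := Equiv.ext fun t => (key t).1
  refine SemidirectProduct.ext ?_ hr
  funext t
  have := (key (w.right.symm t)).2
  rw [← hr] at this
  simpa using this

/-- `w ↦ ξ_{u, u w⁻¹}` is multiplicative when `r ≤ n`. -/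
lemma xi_mul_xi (h : r ≤ n) (w w' : ExtAffineWeyl r) :
    xi K n (uTuple r) (act n (uTuple r) w⁻¹) * xi K n (uTuple r) (act n (uTuple r) w'⁻¹) =
      xi K n (uTuple r) (act n (uTuple r) (w * w')⁻¹) := by
  classical
  refine ent_ext fun p q => ?_
  have row : ∀ v z s, orb n (act n (uTuple r) z) s = orb n (uTuple r) (act n (uTuple r) v) ↔
      s = act n (uTuple r) (v * z) := by
    intro v z s
    rw [eq_comm, orb_eq_iff]
    constructor
    · rintro ⟨x, h1, h2⟩
      have := act_uTuple_injective h h1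
      rw [← h2, ← act_mul, this]
    · rintro rfl
      exact ⟨z, rfl, (act_mul _ _ _).symm⟩
  by_cases hp : ∃ z, p = act n (uTuple r) z
  · obtain ⟨z, rfl⟩ := hp
    rw [ent_mul _ _ _ _ {act n (uTuple r) (w⁻¹ * z)}]
    · simp [xi, ent_basisVec, row, mul_assoc]
    · intro s hs
      simpa [xi, ent_basisVec, row] using hs
  · have hz : ∀ v s, ¬ orb n p s = orb n (uTuple r) v := by
      intro v s hs
      obtain ⟨x, h1, -⟩ := orb_eq_iff.1 hs.symm
      exact hp ⟨x, h1.symm⟩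
    rw [ent_mul _ _ _ _ ∅ (fun s hs => absurd hs (by simp [xi, ent_basisVec, hz]))]
    simp [xi, ent_basisVec, hz]

lemma xi_uu_idem (h : r ≤ n) : IsIdempotentElem (xi K n (uTuple r) (uTuple r)) := by
  have := xi_mul_xi (K := K) h 1 1
  rw [mul_one, inv_one, act_one] at this
  exact this

end AffineSchur

section corner

variable {R : Type u} [Ring R] {e : R}

/-- The corner ring `e R e` of a `K`-algebra is a `K`-algebra. -/
instance IsIdempotentElem.Corner.instAlgebra {K : Type*} [CommSemiring K] [Algebra K R]
    (he : IsIdempotentElem e) : Algebra K he.Corner where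
  smul c x := ⟨c • x.1, by
    obtain ⟨y, hy⟩ := x.2
    exact ⟨c • y, by rw [← hy]; simp⟩⟩
  algebraMap :=
    { toFun := fun c => ⟨c • e, ⟨c • 1, by simp [he.eq]⟩⟩
      map_one' := Subtype.ext (one_smul K e)
      map_mul' := fun c d => Subtype.ext (by
        show (c * d) • e = (c • e) * (d • e)
        rw [smul_mul_smul_comm, he.eq])
      map_zero' := Subtype.ext (zero_smul K e)
      map_add' := fun c d => Subtype.ext (add_smul c d e) }
  commutes' c x := Subtype.ext (by
    have := (Subsemigroup.mem_corner_iff he).1 x.2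
    show (c • e) * x.1 = x.1 * (c • e)
    rw [smul_mul_assoc, mul_smul_comm, this.1, this.2])
  smul_def' c x := Subtype.ext (by
    have := (Subsemigroup.mem_corner_iff he).1 x.2
    show c • x.1 = (c • e) * x.1
    rw [smul_mul_assoc, this.1])

/-- The subgroup `e W = {e w | w ∈ W}` of an `R`-module `W`. -/
def IsIdempotentElem.CornerModule (_ : IsIdempotentElem e) (W : Type v) [AddCommGroup W]
    [Module R W] : Type v :=
  (DistribSMul.toAddMonoidHom W e).range

namespace IsIdempotentElem.CornerModule

variable (he : IsIdempotentElem e) (W : Type v) [AddCommGroup W] [Module R W]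

instance : AddCommGroup (he.CornerModule W) :=
  inferInstanceAs (AddCommGroup (DistribSMul.toAddMonoidHom W e).range)

/-- `e W` is a module over `e R e`, by restriction of the action of `R` on `W`. -/
instance : Module he.Corner (he.CornerModule W) where
  smul x m := ⟨x.1 • m.1, ⟨x.1 • m.1, by
    show e • x.1 • m.1 = x.1 • m.1
    rw [← mul_smul, ((Subsemigroup.mem_corner_iff he).1 x.2).1]⟩⟩
  one_smul m := Subtype.ext (by
    show e • m.1 = m.1
    obtain ⟨y, hy⟩ := m.2
    rw [← hy]
    show e • e • y = e • y
    rw [← mul_smul, he.eq])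
  mul_smul x y m := Subtype.ext (mul_smul x.1 y.1 m.1)
  smul_zero x := Subtype.ext (smul_zero x.1)
  smul_add x m m' := Subtype.ext (smul_add x.1 m.1 m'.1)
  add_smul x y m := Subtype.ext (add_smul x.1 y.1 m.1)
  zero_smul m := Subtype.ext (zero_smul R m.1)

variable {W}
variable {W' : Type v} [AddCommGroup W'] [Module R W']

/-- The restriction `e W → e W'` of an `R`-linear map `W → W'`. -/
def map (f : W →ₗ[R] W') : he.CornerModule W →ₗ[he.Corner] he.CornerModule W' where
  toFun m := ⟨f m.1, by
    obtain ⟨y, hy⟩ := m.2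
    exact ⟨f y, by rw [← hy]; exact (f.map_smul e y).symm⟩⟩
  map_add' m m' := Subtype.ext (f.map_add m.1 m'.1)
  map_smul' x m := Subtype.ext (f.map_smul x.1 m.1)

end IsIdempotentElem.CornerModule

/-- The functor `W ↦ e W` from `R`-modules to `e R e`-modules. -/
def cornerFunctor (he : IsIdempotentElem e) :
    CategoryTheory.Functor (ModuleCat.{v} R) (ModuleCat.{v} he.Corner) where
  obj W := ModuleCat.of he.Corner (he.CornerModule W)
  map f := ModuleCat.ofHom (IsIdempotentElem.CornerModule.map he f.hom)

end corner

/-- The algebra homomorphism `K[Σ_r ⋉ ℤ^r] → ξ_{u,u} S̃(n, r) ξ_{u,u}`, `w ↦ ξ_{u, u w⁻¹}`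
(which is also `ξ_{u w, u}`), where `u = (1, …, r)` and `r ≤ n`. -/
def AffineSchur.groupAlgebraToCorner (K : Type u) [Field K] {n r : ℕ} [NeZero n] (h : r ≤ n) :
    MonoidAlgebra K (ExtAffineWeyl r) →ₐ[K] (xi_uu_idem (K := K) h).Corner :=
  MonoidAlgebra.lift K _ (ExtAffineWeyl r)
    { toFun := fun w => ⟨xi K n (uTuple r) (act n (uTuple r) w⁻¹),
        (Subsemigroup.mem_corner_iff (xi_uu_idem h)).2 ⟨by
          simpa [act_one] using xi_mul_xi (K := K) h 1 w, by
          simpa [act_one] using xi_mul_xi (K := K) h w 1⟩⟩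
      map_one' := Subtype.ext (by
        show xi K n (uTuple r) (act n (uTuple r) 1⁻¹) = xi K n (uTuple r) (uTuple r)
        rw [inv_one, act_one])
      map_mul' := fun w w' => Subtype.ext (xi_mul_xi (K := K) h w w').symm }

/-- The Schur functor `W ↦ ξ_{u,u} W` from `S̃(n, r)`-modules to modules over the group algebra of
the extended affine Weyl group, where `u = (1, …, r)` and `r ≤ n`. The group algebra acts through
`groupAlgebraToCorner`. -/
def AffineSchur.schurFunctor (K : Type u) [Field K] {n r : ℕ} [NeZero n] (h : r ≤ n) :
    CategoryTheory.Functor (ModuleCat.{v} (AffineSchurAlgebra K n r))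
      (ModuleCat.{v} (MonoidAlgebra K (ExtAffineWeyl r))) :=
  (cornerFunctor (xi_uu_idem (K := K) h)).comp
    (ModuleCat.restrictScalars (groupAlgebraToCorner K h).toRingHom)

end

/-! For (1), an element of the corner has nonzero entries only at pairs (u z, u z'), and each such
pair lies in the orbit of (u, u w⁻¹) with w = z z'⁻¹. Since r ≤ n, the entries of u are distinct
modulo n and u has trivial stabilizer, so different w give different orbits. Hence the images of the
group elements form a basis of the corner (`groupAlgebraToCorner_bijective`).

For (2), Morita theory says that W ↦ e W is an equivalence once e is full, that is, 1 = ∑ x_k e y_k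
(`cornerFunctor_isEquivalence`). Such a relation writes every w as ∑ x_k (e y_k w), which gives full
faithfulness. For essential surjectivity, R e ⊗ N over e R e is realised inside the finite power N^ι
by a ⊗ n ↦ (e y_k a n)_k, as the image of the idempotent matrix (e y_k x_l e).

The idempotent ξ_{u,u} is full because ξ_{i,u} ξ_{u,i} = |Stab i| ξ_{i,i} (`xi_mul_xi_uTuple`). The
stabilizer embeds in Σ_r, so its order divides r! and is invertible in K under the assumption on the
characteristic. Summing ξ_{i,i} over representatives i gives 1. -/

section

/-! ### Morita theory of a full idempotent: matrices over the corner. -/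

namespace IsIdempotentElem

variable {R : Type u} [Ring R] {e : R} (he : IsIdempotentElem e)

/-- The compression `a ↦ e a e` onto the corner ring. -/
def compress : R →+ he.Corner where
  toFun a := ⟨e * a * e, a, rfl⟩
  map_zero' := Subtype.ext (by
    show e * 0 * e = 0
    simp)
  map_add' a b := Subtype.ext (by
    show e * (a + b) * e = e * a * e + e * b * e
    rw [mul_add, add_mul])

lemma compress_mul (a b : R) : he.compress a * he.compress b = he.compress (a * e * b) :=
  Subtype.ext (by
    show e * a * e * (e * b * e) = e * (a * e * b) * e
    simp only [mul_assoc, mul_self_mul he])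

lemma compress_self : he.compress e = 1 :=
  Subtype.ext (by
    show e * e * e = e
    rw [he.eq, he.eq])

lemma compress_coe (a : he.Corner) : he.compress a.1 = a :=
  Subtype.ext (by
    have := (Subsemigroup.mem_corner_iff he).1 a.2
    show e * a.1 * e = a.1
    rw [this.1, this.2])

variable {ι : Type} [Fintype ι] {x y : ι → R}

/-- Inserting `∑ k, x k * e * y k = 1` between two elements of a corner. -/
lemma sum_compress (hxy : ∑ k, x k * e * y k = 1) (a b : R) :
    ∑ k, he.compress (a * x k) * he.compress (y k * b) = he.compress (a * b) := by
  simp only [compress_mul, ← map_sum]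
  congr 1
  calc ∑ k, a * x k * e * (y k * b) = a * (∑ k, x k * e * y k) * b := by
        simp only [Finset.mul_sum, Finset.sum_mul, mul_assoc]
    _ = a * b := by rw [hxy, mul_one]

variable (N : Type v) [AddCommGroup N] [Module he.Corner N]

/-- The action on `ι → N` of the matrix with entries `e (y k) a (x l) e`. -/
def matrixAction (x y : ι → R) (a : R) : (ι → N) →+ (ι → N) where
  toFun m k := ∑ l, he.compress (y k * a * x l) • m l
  map_zero' := by funext; simp
  map_add' m m' := by funext; simp [Finset.sum_add_distrib]

variable {N}

lemma matrixAction_apply (a : R) (m : ι → N) (k : ι) :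
    he.matrixAction N x y a m k = ∑ l, he.compress (y k * a * x l) • m l := rfl

/-- The sum over the middle index of the matrix product contains ∑ x_j e y_j = 1, which collapses.
-/
lemma matrixAction_mul (hxy : ∑ k, x k * e * y k = 1) (a b : R) (m : ι → N) :
    he.matrixAction N x y (a * b) m = he.matrixAction N x y a (he.matrixAction N x y b m) := by
  funext k
  simp only [matrixAction_apply, Finset.smul_sum, smul_smul]
  rw [Finset.sum_comm]
  refine Finset.sum_congr rfl fun l _ => ?_
  rw [← Finset.sum_smul]
  congr 1
  simpa only [mul_assoc] using (he.sum_compress hxy (y k * a) (b * x l)).symm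

variable (N) in
/-- The `R`-module attached to a module `N` over the corner `e R e`, when
`∑ k, x k * e * y k = 1`: the image of the idempotent matrix `(e (y k) (x l) e)` in `ι → N`. -/
def Induced (_ : ∑ k, x k * e * y k = 1) : Type v :=
  {m : ι → N // he.matrixAction N x y 1 m = m}

/-! ### Essential surjectivity: the induced module and its corner. -/

namespace Induced

variable (hxy : ∑ k, x k * e * y k = 1)

instance : AddCommGroup (he.Induced N hxy) :=
  inferInstanceAs (AddCommGroup
    (AddMonoidHom.eqLocus (he.matrixAction N x y 1) (AddMonoidHom.id (ι → N))))

/-- On all of ι → N the unit acts by an idempotent matrix that need not be the identity. Restricting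
to its fixed vectors makes the unit law hold by definition, and multiplicativity keeps the action
inside them. -/
instance : Module R (he.Induced N hxy) where
  smul a m := ⟨he.matrixAction N x y a m.1, by rw [← matrixAction_mul he hxy, one_mul]⟩
  one_smul m := Subtype.ext m.2
  mul_smul a b m := Subtype.ext (matrixAction_mul he hxy a b m.1)
  smul_zero a := Subtype.ext (map_zero (he.matrixAction N x y a))
  smul_add a m m' := Subtype.ext (map_add (he.matrixAction N x y a) m.1 m'.1)
  add_smul a b m := Subtype.ext (by
    funext k
    show ∑ l, he.compress (y k * (a + b) * x l) • m.1 l =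
      ∑ l, he.compress (y k * a * x l) • m.1 l + ∑ l, he.compress (y k * b * x l) • m.1 l
    simp [mul_add, add_mul, add_smul, Finset.sum_add_distrib])
  zero_smul m := Subtype.ext (by
    funext k
    show ∑ l, he.compress (y k * 0 * x l) • m.1 l = 0
    simp only [mul_zero, zero_mul, map_zero]
    exact Finset.sum_eq_zero fun l _ => zero_smul he.Corner (m.1 l))

variable (N) in
/-- The corner of the induced module is the original module. -/
def cornerEquiv : he.CornerModule (he.Induced N hxy) ≃ₗ[he.Corner] N where
  -- A family m stands for the tensor ∑ x_l e ⊗ m_l; multiplying by e puts it in e R e ⊗ N = N.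
  toFun m := ∑ l, he.compress (x l) • m.1.1 l
  map_add' m m' := by
    show ∑ l, he.compress (x l) • (m.1.1 l + m'.1.1 l) = _
    simp [Finset.sum_add_distrib]
  map_smul' a m := by
    show ∑ l, he.compress (x l) • (he.matrixAction N x y a.1 m.1.1) l =
      a • ∑ l, he.compress (x l) • m.1.1 l
    simp only [matrixAction_apply, Finset.smul_sum, smul_smul]
    rw [Finset.sum_comm]
    refine Finset.sum_congr rfl fun l _ => ?_
    rw [← Finset.sum_smul]
    congr 1
    have h := he.sum_compress hxy 1 (a.1 * x l)
    simp only [one_mul, ← mul_assoc] at h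
    rw [h]
    conv_rhs => rw [← he.compress_coe a, compress_mul,
      ((Subsemigroup.mem_corner_iff he).1 a.2).2]
  invFun n := ⟨⟨fun k => he.compress (y k) • n, by
    funext k
    simp only [matrixAction_apply, smul_smul, ← Finset.sum_smul]
    congr 1
    simpa using he.sum_compress hxy (y k) 1⟩, by
    -- The family is fixed by e, so it serves as its own preimage under e.
    refine ⟨⟨fun k => he.compress (y k) • n, ?_⟩, Subtype.ext ?_⟩
    · funext k
      simp only [matrixAction_apply, smul_smul, ← Finset.sum_smul]
      congr 1
      simpa using he.sum_compress hxy (y k) 1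
    · funext k
      show ∑ l, he.compress (y k * e * x l) • he.compress (y l) • n = _
      simp only [smul_smul, ← Finset.sum_smul]
      congr 1
      have h := he.sum_compress hxy (y k * e) 1
      simp only [mul_one] at h
      rw [h]
      conv_rhs => rw [← mul_one (he.compress (y k)), ← he.compress_self, compress_mul]
      rw [mul_assoc, he.eq]⟩
  left_inv m := by
    refine Subtype.ext (Subtype.ext ?_)
    obtain ⟨w, hw⟩ := m.2
    have hm : e • m.1 = m.1 := by
      rw [← hw]
      show e • e • w = e • w
      rw [← mul_smul, he.eq]
    conv_rhs => rw [← hm]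
    -- The composite of the two maps is the matrix of e, which fixes m.
    funext k
    show he.compress (y k) • ∑ l, he.compress (x l) • m.1.1 l =
      ∑ l, he.compress (y k * e * x l) • m.1.1 l
    simp only [Finset.smul_sum, smul_smul, compress_mul]
  right_inv n := by
    show ∑ l, he.compress (x l) • he.compress (y l) • n = n
    simp only [smul_smul, ← Finset.sum_smul]
    have h := he.sum_compress hxy 1 e
    have h' : ∀ l, he.compress (y l * e) = he.compress (y l) := fun l => by
      conv_rhs => rw [← mul_one (he.compress (y l)), ← he.compress_self, compress_mul]
      rw [mul_assoc, he.eq]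
    simp only [one_mul, h', compress_self] at h
    rw [h, one_smul]

end Induced

/-! ### Full faithfulness: extending maps from the corner. -/

namespace CornerModule

variable {W : Type v} [AddCommGroup W] [Module R W]

/-- The projection `w ↦ e w`. -/
def proj : W →+ he.CornerModule W where
  toFun w := ⟨e • w, w, rfl⟩
  map_zero' := Subtype.ext (smul_zero e)
  map_add' w w' := Subtype.ext (smul_add e w w')

lemma coe_proj (w : W) : (proj he w).1 = e • w := rfl

lemma proj_coe (m : he.CornerModule W) : proj he m.1 = m := one_smul he.Corner m

lemma compress_smul_proj (a : R) (w : W) :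
    he.compress a • proj he w = proj he (a • e • w) :=
  Subtype.ext (by
    show (e * a * e) • e • w = e • a • e • w
    simp only [← mul_smul, mul_assoc, he.eq])

lemma compress_smul (a : R) (m : he.CornerModule W) :
    he.compress a • m = proj he (a • m.1) := by
  have h := compress_smul_proj he a m.1
  have hm : e • m.1 = m.1 := congrArg Subtype.val (proj_coe he m)
  rwa [proj_coe, hm] at h

/-- Fullness of e recovers w from its finitely many corner coordinates e y_k w. -/
lemma sum_smul_proj (hxy : ∑ k, x k * e * y k = 1) (w : W) :
    ∑ k, x k • (proj he (y k • w)).1 = w := by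
  simp only [coe_proj, ← mul_smul, ← mul_assoc, ← Finset.sum_smul, hxy, one_smul]

/-- Substituting w = ∑ x_k e y_k w expresses e a w through the coordinates of w with coefficients in
e R e, so that corner-linear maps can be applied term by term. -/
lemma proj_smul (hxy : ∑ k, x k * e * y k = 1) (a : R) (w : W) :
    proj he (a • w) = ∑ k, he.compress (a * x k) • proj he (y k • w) := by
  simp only [compress_smul_proj, ← map_sum]
  congr 1
  conv_lhs => rw [← sum_smul_proj he hxy w]
  simp only [Finset.smul_sum, coe_proj, mul_smul]

variable {W' : Type v} [AddCommGroup W'] [Module R W']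

/-- The `R`-linear extension of a map of corners, when `∑ k, x k * e * y k = 1`. -/
def extend (hxy : ∑ k, x k * e * y k = 1)
    (g : he.CornerModule W →ₗ[he.Corner] he.CornerModule W') : W →ₗ[R] W' where
  -- This formula is forced by R-linearity and w = ∑ x_k (e y_k w).
  toFun w := ∑ k, x k • (g (proj he (y k • w))).1
  map_add' w w' := by
    rw [← Finset.sum_add_distrib]
    refine Finset.sum_congr rfl fun k _ => ?_
    rw [smul_add, map_add, map_add, ← smul_add]
    rfl
  map_smul' a w := by
    -- Writing f for the extension, corner linearity of g gives g(e y_k a w) = e y_k a f(w); these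
    -- are the coordinates of a f(w), which they determine.
    have key : ∀ k, g (proj he (y k • a • w)) =
        proj he (y k • a • ∑ l, x l • (g (proj he (y l • w))).1) := fun k => by
      rw [← mul_smul, proj_smul he hxy, map_sum, ← mul_smul, Finset.smul_sum, map_sum]
      refine Finset.sum_congr rfl fun l _ => ?_
      rw [map_smul, compress_smul, mul_smul (y k * a)]
    simp only [key, RingHom.id_apply]
    exact sum_smul_proj he hxy _

lemma map_extend (hxy : ∑ k, x k * e * y k = 1)
    (g : he.CornerModule W →ₗ[he.Corner] he.CornerModule W') : map he (extend he hxy g) = g := by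
  refine LinearMap.ext fun m => Subtype.ext ?_
  show ∑ k, x k • (g (proj he (y k • m.1))).1 = (g m).1
  conv_rhs => rw [← sum_smul_proj he hxy (g m).1]
  refine Finset.sum_congr rfl fun k _ => ?_
  rw [← compress_smul, ← compress_smul, map_smul]

lemma map_injective (hxy : ∑ k, x k * e * y k = 1) {f g : W →ₗ[R] W'}
    (h : map he f = map he g) : f = g := by
  refine LinearMap.ext fun w => ?_
  rw [← sum_smul_proj he hxy w, map_sum, map_sum]
  refine Finset.sum_congr rfl fun k _ => ?_
  rw [f.map_smul, g.map_smul]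
  exact congrArg (x k • ·)
    (congrArg Subtype.val (LinearMap.congr_fun h (proj he (y k • w))))

end CornerModule

end IsIdempotentElem

/-- If `e` is a full idempotent, then `W ↦ e W` is an equivalence of categories. -/
theorem cornerFunctor_isEquivalence {R : Type u} [Ring R] {e : R} (he : IsIdempotentElem e)
    {ι : Type} [Fintype ι] {x y : ι → R} (hxy : ∑ k, x k * e * y k = 1) :
    (cornerFunctor.{u, v} he).IsEquivalence where
  faithful := ⟨fun h => ModuleCat.hom_ext
    (IsIdempotentElem.CornerModule.map_injective he hxy (congrArg ModuleCat.Hom.hom h))⟩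
  full := ⟨fun g => ⟨ModuleCat.ofHom (IsIdempotentElem.CornerModule.extend he hxy g.hom),
    ModuleCat.hom_ext (IsIdempotentElem.CornerModule.map_extend he hxy g.hom)⟩⟩
  essSurj := ⟨fun N => ⟨ModuleCat.of R (he.Induced N hxy),
    ⟨(IsIdempotentElem.Induced.cornerEquiv he N hxy).toModuleIso⟩⟩⟩

end

section

/-! ### The corner at u is the group algebra. -/

namespace AffineSchur

variable {K : Type u} [Field K] {n r : ℕ}

/-- An element relating two such pairs fixes u, hence is 1. -/
lemma orb_uTuple_injective (h : r ≤ n) : Function.Injective fun w : ExtAffineWeyl r =>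
    orb n (uTuple r) (act n (uTuple r) w⁻¹) := by
  intro w w' hw
  obtain ⟨z, h1, h2⟩ := orb_eq_iff.1 hw
  obtain rfl : z = 1 := act_uTuple_injective h (h1.trans (act_one _).symm)
  rw [act_one] at h2
  exact inv_injective (act_uTuple_injective h h2)

/-- The map merely relabels coefficients by orbits, so bijectivity becomes injectivity of the
relabelling plus a bound on the supports of corner elements. -/
lemma groupAlgebraToCorner_val [NeZero n] (h : r ≤ n) (g : MonoidAlgebra K (ExtAffineWeyl r)) :
    (groupAlgebraToCorner K h g).1 =
      Finsupp.mapDomain (fun w => orb n (uTuple r) (act n (uTuple r) w⁻¹)) g.coeff := by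
  induction g using MonoidAlgebra.induction_linear with
  | zero => rw [map_zero]; exact Finsupp.mapDomain_zero.symm
  | add f g hf hg =>
    rw [map_add, MonoidAlgebra.coeff_add, Finsupp.mapDomain_add, ← hf, ← hg]
    rfl
  | single w c =>
    refine Eq.trans ?_ Finsupp.mapDomain_single.symm
    rw [groupAlgebraToCorner, MonoidAlgebra.lift_single]
    show c • Finsupp.single _ (1 : K) = _
    rw [Finsupp.smul_single, smul_eq_mul, mul_one]

lemma exists_of_ent_xi_ne_zero {i j p q : Fin r → ℤ} (h : ent p q (xi K n i j) ≠ 0) :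
    ∃ w, p = act n i w ∧ q = act n j w := by
  classical
  rw [xi, ent_basisVec, ne_eq, ite_eq_right_iff, not_forall] at h
  obtain ⟨h, -⟩ := h
  obtain ⟨w, h1, h2⟩ := orb_eq_iff.1 h.symm
  exact ⟨w, h1.symm, h2.symm⟩

lemma groupAlgebraToCorner_bijective [NeZero n] (h : r ≤ n) :
    Function.Bijective (groupAlgebraToCorner K h) := by
  constructor
  · intro f g hfg
    have := congrArg Subtype.val hfg
    rw [groupAlgebraToCorner_val, groupAlgebraToCorner_val] at this
    exact MonoidAlgebra.coeff_injective
      (Finsupp.mapDomain_injective (orb_uTuple_injective h) this)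
  · intro f
    refine ⟨.ofCoeff (Finsupp.comapDomain _ f.1 (orb_uTuple_injective h).injOn),
      Subtype.ext ?_⟩
    rw [groupAlgebraToCorner_val]
    refine Finsupp.mapDomain_comapDomain _ (orb_uTuple_injective h) _ ?_
    intro c hc
    obtain ⟨p, q, rfl⟩ := exists_orb c
    have hf := (Subsemigroup.mem_corner_iff (xi_uu_idem (K := K) h)).1 f.2
    have h0 : ent p q f.1 ≠ 0 := Finsupp.mem_support_iff.1 hc
    have h1 := h0
    -- From ξ_{u,u} f = f, a nonzero entry lies in a row u z; below, f ξ_{u,u} = f puts it in a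
    -- column u z'.
    rw [← hf.1, ent_mul_self] at h1
    obtain ⟨s, -, hs⟩ := Finset.exists_ne_zero_of_sum_ne_zero h1
    obtain ⟨z, rfl, -⟩ := exists_of_ent_xi_ne_zero (left_ne_zero_of_mul hs)
    rw [← hf.2, ent_mul_self] at h0
    obtain ⟨s, -, hs⟩ := Finset.exists_ne_zero_of_sum_ne_zero h0
    obtain ⟨z', -, rfl⟩ := exists_of_ent_xi_ne_zero (right_ne_zero_of_mul hs)
    -- Acting by z⁻¹ turns (u z, u z') into (u, u z' z⁻¹).
    refine ⟨z * z'⁻¹, ?_⟩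
    refine (orb_act _ _ z).symm.trans ?_
    simp [← act_mul]

/-! ### Stabilizers and fullness of ξ_{u,u}. -/

/-- The stabilizer of a tuple in the extended affine Weyl group. -/
def stabilizer (n : ℕ) (i : Fin r → ℤ) : Subgroup (ExtAffineWeyl r) where
  carrier := {w | act n i w = i}
  one_mem' := act_one i
  mul_mem' {w w'} hw hw' := by
    rw [Set.mem_ofPred_eq] at hw hw' ⊢
    rw [act_mul, hw, hw']
  inv_mem' {w} hw := by
    rw [Set.mem_ofPred_eq] at hw ⊢
    conv_lhs => rw [← hw, ← act_mul, mul_inv_cancel, act_one]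

lemma mem_stabilizer {i : Fin r → ℤ} {w : ExtAffineWeyl r} :
    w ∈ stabilizer n i ↔ act n i w = i := Iff.rfl

/-- A stabilizer is isomorphic to a subgroup of the symmetric group. -/
lemma card_stabilizer_dvd [NeZero n] (i : Fin r → ℤ) :
    Nat.card (stabilizer n i) ∣ r.factorial := by
  have hinj : Function.Injective
      (SemidirectProduct.rightHom.comp (stabilizer n i).subtype) := by
    rw [injective_iff_map_eq_one]
    rintro ⟨w, hw⟩ h
    -- With trivial permutation part, w translates by n ε; it fixes i only if ε = 0, as n ≠ 0.
    have hr : w.right = 1 := h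
    refine Subtype.ext (SemidirectProduct.ext ?_ hr)
    funext t
    have := congrFun (mem_stabilizer.1 hw) t
    simp only [act, hr, Equiv.Perm.one_apply, add_eq_left, mul_eq_zero, Int.natCast_eq_zero,
      NeZero.ne n, false_or] at this
    exact Multiplicative.toAdd.injective this
  have := Subgroup.card_dvd_of_injective _ hinj
  rwa [Nat.card_eq_fintype_card (α := Equiv.Perm (Fin r)), Fintype.card_perm,
    Fintype.card_fin] at this

/-- A prime dividing r! is at most r. -/
lemma natCast_ne_zero_of_dvd_factorial (hK : ringChar K = 0 ∨ r < ringChar K) {d : ℕ}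
    (hd : d ∣ r.factorial) : (d : K) ≠ 0 := by
  intro h0
  rw [ringChar.spec] at h0
  have h1 := h0.trans hd
  rcases hK with hK | hK
  · rw [hK, zero_dvd_iff] at h1
    exact r.factorial_ne_zero h1
  · rcases CharP.char_is_prime_or_zero K (ringChar K) with hp | hp
    · exact absurd ((hp.dvd_factorial).1 h1) (by omega)
    · omega

/-- `ξ_{i,u} ξ_{u,i}` is the order of the stabilizer of `i` times `ξ_{i,i}`. -/
lemma xi_mul_xi_uTuple (h : r ≤ n) (i : Fin r → ℤ) :
    xi K n i (uTuple r) * xi K n (uTuple r) i =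
      (Nat.card (stabilizer n i) : K) • xi K n i i := by
  classical
  -- Since u has trivial stabilizer, the middle index s = u w determines w, and the two orbit
  -- conditions become i w = p and i w = q.
  have hset : ∀ p q, {s | orb n p s = orb n i (uTuple r) ∧ orb n s q = orb n (uTuple r) i} =
      (fun w => act n (uTuple r) w) '' {w | act n i w = p ∧ act n i w = q} := by
    intro p q
    ext s
    constructor
    · rintro ⟨h1, h2⟩
      obtain ⟨w, rfl, rfl⟩ := orb_eq_iff.1 h1.symm
      obtain ⟨w', h3, rfl⟩ := orb_eq_iff.1 h2.symm
      obtain rfl := act_uTuple_injective h h3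
      exact ⟨w', ⟨rfl, rfl⟩, rfl⟩
    · rintro ⟨w, ⟨rfl, rfl⟩, rfl⟩
      exact ⟨orb_act _ _ _, orb_act _ _ _⟩
  refine ent_ext fun p q => ?_
  rw [xi, xi, basisVec_mul_basisVec, ent_mulBasis, structConst_orb, hset,
    Set.ncard_image_of_injective _ (act_uTuple_injective h), map_smul, xi, ent_basisVec,
    smul_eq_mul, mul_ite, mul_one, mul_zero]
  split_ifs with hpq
  · obtain ⟨z, rfl, rfl⟩ := orb_eq_iff.1 hpq.symm
    congr 1
    rw [← Nat.card_coe_set_eq]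
    -- The elements taking i to i z form the coset Stab(i) z.
    refine Nat.card_congr ((Equiv.mulRight z⁻¹).subtypeEquiv fun w => ?_)
    simp only [and_self, Set.mem_ofPred_eq, mem_stabilizer, Equiv.coe_mulRight, act_mul]
    constructor
    · intro hw
      rw [hw, ← act_mul, mul_inv_cancel, act_one]
    · intro hw
      conv_rhs => rw [← hw, ← act_mul, inv_mul_cancel, act_one]
  · have : {w | act n i w = p ∧ act n i w = q} = ∅ := by
      ext w
      simp only [Set.mem_ofPred_eq, Set.mem_empty_iff_false, iff_false]
      rintro ⟨rfl, rfl⟩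
      exact hpq (orb_act _ _ _)
    rw [this, Set.ncard_empty, Nat.cast_zero]

/-- The relation (p, s) ∼ (i, i) forces s = p, so each structure constant is 0 or 1. This absorbs
the factor ξ_{u,u} in ξ_{i,u} ξ_{u,u} ξ_{u,i}. -/
lemma xi_self_mul_xi (i j : Fin r → ℤ) : xi K n i i * xi K n i j = xi K n i j := by
  classical
  refine ent_ext fun p q => ?_
  rw [xi, xi, basisVec_mul_basisVec, ent_mulBasis, structConst_orb, ent_basisVec]
  split_ifs with hpq
  · have : {s | orb n p s = orb n i i ∧ orb n s q = orb n i j} = {p} := by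
      ext s
      constructor
      · rintro ⟨h, -⟩
        obtain ⟨w, rfl, rfl⟩ := orb_eq_iff.1 h.symm
        rfl
      · rintro rfl
        obtain ⟨w, rfl, rfl⟩ := orb_eq_iff.1 hpq.symm
        exact ⟨orb_act _ _ _, hpq⟩
    rw [this, Set.ncard_singleton, Nat.cast_one]
  · have : {s | orb n p s = orb n i i ∧ orb n s q = orb n i j} = ∅ := by
      ext s
      simp only [Set.mem_ofPred_eq, Set.mem_empty_iff_false, iff_false]
      rintro ⟨h, h'⟩
      obtain ⟨w, rfl, rfl⟩ := orb_eq_iff.1 h.symm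
      exact hpq h'
    rw [this, Set.ncard_empty, Nat.cast_zero]

/-- If `r!` is invertible in `K`, then `ξ_{u,u}` is a full idempotent. -/
lemma exists_sum_mul_xi_mul_eq_one [NeZero n] (h : r ≤ n)
    (hK : ringChar K = 0 ∨ r < ringChar K) :
    ∃ (ι : Type) (_ : Fintype ι) (x y : ι → AffineSchurAlgebra K n r),
      ∑ k, x k * xi K n (uTuple r) (uTuple r) * y k = 1 := by
  classical
  let S : Finset (Orbit n r) := Finset.univ.image fun i : Fin r → Fin n =>
    orb n (fun t => (i t : ℤ) + 1) (fun t => (i t : ℤ) + 1)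
  have hS : ∀ a : S, ∃ x y : AffineSchurAlgebra K n r,
      x * xi K n (uTuple r) (uTuple r) * y = basisVec K a.1 := by
    rintro ⟨a, ha⟩
    obtain ⟨i, -, rfl⟩ := Finset.mem_image.1 ha
    refine ⟨(Nat.card (stabilizer n fun t => (i t : ℤ) + 1) : K)⁻¹ •
      xi K n (fun t => (i t : ℤ) + 1) (uTuple r), xi K n (uTuple r) fun t => (i t : ℤ) + 1, ?_⟩
    rw [mul_assoc, xi_self_mul_xi, smul_mul_assoc, xi_mul_xi_uTuple h,
      inv_smul_smul₀ (natCast_ne_zero_of_dvd_factorial hK (card_stabilizer_dvd _))]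
    rfl
  choose x y hxy using hS
  refine ⟨S, inferInstance, x, y, ?_⟩
  simp only [hxy]
  -- `S` is the index set in the definition of the identity of the algebra.
  exact Finset.sum_coe_sort S (basisVec K)

end AffineSchur

end

theorem theoremT {K : Type u} [Field K] (n r : ℕ) [NeZero n] (hrn : r ≤ n) :
    Function.Bijective (AffineSchur.groupAlgebraToCorner K hrn) ∧
      (ringChar K = 0 ∨ r < ringChar K →
        (AffineSchur.schurFunctor.{u, v} K hrn).IsEquivalence) := by
  have hbij := AffineSchur.groupAlgebraToCorner_bijective (K := K) hrn
  refine ⟨hbij, fun hK => ?_⟩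
  obtain ⟨ι, _, x, y, hxy⟩ := AffineSchur.exists_sum_mul_xi_mul_eq_one hrn hK
  have h1 := cornerFunctor_isEquivalence.{u, v} (AffineSchur.xi_uu_idem (K := K) hrn) hxy
  have h2 : (ModuleCat.restrictScalars.{v}
      (AffineSchur.groupAlgebraToCorner K hrn).toRingHom).IsEquivalence :=
    ModuleCat.restrictScalars_isEquivalence_of_ringEquiv (RingEquiv.ofBijective
      (AffineSchur.groupAlgebraToCorner K hrn).toRingHom hbij)
  exact CategoryTheory.Functor.isEquivalence_trans _ _
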